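/- Let $q$ be a positive integer and let $\kappa\in\{0,1,2,\dots\}\cup\{+\infty\}$. All sequences $(s_j)_{j=0}^{\kappa}$ below consist of complex $q\times q$ matrices (for $\kappa=+\infty$, $j$ runs through all non-negative integers, and $\infty-1=\infty-k=\infty$). $A^{\dagger}$ denotes the Moore–Penrose inverse of a matrix $A$. Let $\alpha\in\mathbb R$. **Transform.** If $\kappa\ge 1$, put $u_0:=s_0$, $u_j:=-\alpha s_{j-1}+s_j$ for $1\le j\le\kappa$, then $r_0:=u_0^{\dagger}$ and $r_j:=-u_0^{\dagger}\sum_{l=0}^{j-1}u_{j-l}r_l$ for $1\le j\le\kappa$. The first $\alpha$-Schur–Stieltjes transform of $(s_j)_{j=0}^{\kappa}$ is the sequence $(s_j^{[1,\alpha]})_{j=0}^{\kappa-1}$ with $s_j^{[1,\alpha]}:=-s_0\,r_{j+1}\,s_0$. The $0$-th transform is $s_j^{[0,\alpha]}:=s_j$ $(0\le j\le\kappa)$, and for $1\le k\le\kappa$ the $k$-th transform $(s_j^{[k,\alpha]})_{j=0}^{\kappa-k}$ is the first transform of the $(k-1)$-th transform $(s_j^{[k-1,\alpha]})_{j=0}^{\kappa-(k-1)}$.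 **Classes.** Write $H_n(s):=[s_{j+k}]_{j,k=0}^{n}$ for the block Hankel matrix, $a_j:=-\alpha s_j+s_{j+1}$, and $L_0(s):=s_0$, $L_n(s):=s_{2n}-[s_n,\dots,s_{2n-1}]\,H_{n-1}(s)^{\dagger}\,\mathrm{col}(s_n,\dots,s_{2n-1})$ for $n\ge1$. * $\mathcal K^{\ge}_{q,0,\alpha}$ is the set of all $(s_j)_{j=0}^{0}$ with $s_0$ non-negative Hermitian; $\mathcal K^{\ge}_{q,2n,\alpha}$ ($n\ge1$) is the set of all $(s_j)_{j=0}^{2n}$ such that $H_n(s)$ and $H_{n-1}(a)$ are non-negative Hermitian; $\mathcal K^{\ge}_{q,2n+1,\alpha}$ ($n\ge0$) is the set of all $(s_j)_{j=0}^{2n+1}$ such that $H_n(s)$ and $H_n(a)$ are non-negative Hermitian; $\mathcal K^{\ge}_{q,\infty,\alpha}$ is the set of all $(s_j)_{j=0}^{\infty}$ with $(s_j)_{j=0}^{m}\in\mathcal K^{\ge}_{q,m,\alpha}$ for all $m\ge0$. * $\mathcal K^{>}_{q,\kappa,\alpha}$ is defined in the same way, with "positive Hermitian" (i.e. positive definite)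 in place of "non-negative Hermitian". * For finite $m$, $\mathcal K^{\ge,e}_{q,m,\alpha}$ is the set of all $(s_j)_{j=0}^{m}$ for which there is a complex $q\times q$ matrix $s_{m+1}$ with $(s_j)_{j=0}^{m+1}\in\mathcal K^{\ge}_{q,m+1,\alpha}$; and $\mathcal K^{\ge,e}_{q,\infty,\alpha}:=\mathcal K^{\ge}_{q,\infty,\alpha}$. * $\mathcal K^{\ge,cd}_{q,2n,\alpha}$ is the set of all $(s_j)_{j=0}^{2n}\in\mathcal K^{\ge}_{q,2n,\alpha}$ with $L_n(s)=0$; $\mathcal K^{\ge,cd}_{q,2n+1,\alpha}$ is the set of all $(s_j)_{j=0}^{2n+1}\in\mathcal K^{\ge}_{q,2n+1,\alpha}$ with $L_n(a)=0$; $\mathcal K^{\ge,cd}_{q,\infty,\alpha}$ is the set of all $(s_j)_{j=0}^{\infty}\in\mathcal K^{\ge}_{q,\infty,\alpha}$ such that $(s_j)_{j=0}^{m}\in\mathcal K^{\ge,cd}_{q,m,\alpha}$ for some integer $m\ge0$. * For an integer $m$ with $0\le m\le\kappa$, $\mathcal K^{\ge,cd,m}_{q,\kappa,\alpha}$ is the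 set of all $(s_j)_{j=0}^{\kappa}\in\mathcal K^{\ge}_{q,\kappa,\alpha}$ with $(s_j)_{j=0}^{m}\in\mathcal K^{\ge,cd}_{q,m,\alpha}$. **Theorem.** Let $\alpha\in\mathbb R$, let $\kappa\in\{0,1,2,\dots\}\cup\{+\infty\}$, let $(s_j)_{j=0}^{\kappa}$ be a sequence of complex $q\times q$ matrices, and let $k$ be an integer with $0\le k\le\kappa$. Then: (a) If $(s_j)_{j=0}^{\kappa}\in\mathcal K^{\ge}_{q,\kappa,\alpha}$, then $(s_j^{[k,\alpha]})_{j=0}^{\kappa-k}\in\mathcal K^{\ge}_{q,\kappa-k,\alpha}$. (b) If $(s_j)_{j=0}^{\kappa}\in\mathcal K^{\ge,e}_{q,\kappa,\alpha}$, then $(s_j^{[k,\alpha]})_{j=0}^{\kappa-k}\in\mathcal K^{\ge,e}_{q,\kappa-k,\alpha}$. (c) If $(s_j)_{j=0}^{\kappa}\in\mathcal K^{>}_{q,\kappa,\alpha}$, then $(s_j^{[k,\alpha]})_{j=0}^{\kappa-k}\in\mathcal K^{>}_{q,\kappa-k,\alpha}$. (d) If $m$ is an integer with $0\le m\le\kappa$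 and $(s_j)_{j=0}^{\kappa}\in\mathcal K^{\ge,cd,m}_{q,\kappa,\alpha}$, then $(s_j^{[k,\alpha]})_{j=0}^{\kappa-k}\in\mathcal K^{\ge,cd,\max\{0,m-k\}}_{q,\kappa-k,\alpha}$. (e) If $(s_j)_{j=0}^{\kappa}\in\mathcal K^{\ge,cd}_{q,\kappa,\alpha}$, then $(s_j^{[k,\alpha]})_{j=0}^{\kappa-k}\in\mathcal K^{\ge,cd}_{q,\kappa-k,\alpha}$. -/

import Mathlib

namespace SchurStieltjes

open Matrix
open scoped ComplexOrder

/-! Throughout, a finite or infinite sequence `s_0, s_1, …, s_κ` with `κ : ℕ∞` is represented by a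
function on all of `ℕ`, of which only the values at indices `j ≤ κ` are ever relevant: a class of
sequences of length `κ` only looks at these values, and the `j`-th term of the `k`-th transform only
looks at the terms with index at most `j + k`. -/

section MoorePenrose

/-- The four Penrose equations: `X` is the Moore-Penrose inverse of `A`. -/
structure IsMoorePenrose {m n : Type*} [Fintype m] [Fintype n]
    (A : Matrix m n ℂ) (X : Matrix n m ℂ) : Prop where
  mul_mul_left : A * X * A = A
  mul_mul_right : X * A * X = X
  isHermitian_left : (A * X).IsHermitian
  isHermitian_right : (X * A).IsHermitian

theorem IsMoorePenrose.unique {m n : Type*} [Fintype m] [Fintype n]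
    {A : Matrix m n ℂ} {X Y : Matrix n m ℂ}
    (hX : IsMoorePenrose A X) (hY : IsMoorePenrose A Y) : X = Y := by
  have h1 : A * X = A * Y := by
    calc A * X = (A * X)ᴴ := hX.isHermitian_left.eq.symm
      _ = ((A * Y) * (A * X))ᴴ := by
          rw [← Matrix.mul_assoc (A * Y) A X, hY.mul_mul_left]
      _ = (A * X) * (A * Y) := by
          rw [conjTranspose_mul, hX.isHermitian_left.eq, hY.isHermitian_left.eq]
      _ = A * Y := by rw [← Matrix.mul_assoc (A * X) A Y, hX.mul_mul_left]
  have h2 : X * A = Y * A := by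
    calc X * A = (X * A)ᴴ := hX.isHermitian_right.eq.symm
      _ = ((X * A) * (Y * A))ᴴ := by
          rw [Matrix.mul_assoc X A (Y * A), ← Matrix.mul_assoc A Y A, hY.mul_mul_left]
      _ = (Y * A) * (X * A) := by
          rw [conjTranspose_mul, hX.isHermitian_right.eq, hY.isHermitian_right.eq]
      _ = Y * A := by
          rw [Matrix.mul_assoc Y A (X * A), ← Matrix.mul_assoc A X A, hX.mul_mul_left]
  calc X = X * A * X := hX.mul_mul_right.symm
    _ = Y * (A * X) := by rw [h2, Matrix.mul_assoc]
    _ = Y * A * Y := by rw [h1, Matrix.mul_assoc]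
    _ = Y := hY.mul_mul_right

theorem exists_isMoorePenrose_of_isHermitian {n : Type*} [Fintype n]
    {B : Matrix n n ℂ} (hB : B.IsHermitian) :
    ∃ X : Matrix n n ℂ, X.IsHermitian ∧ IsMoorePenrose B X := by
  classical
  obtain ⟨U, V, d, hVU, hV, hBd⟩ : ∃ (U V : Matrix n n ℂ) (d : n → ℝ), V * U = 1 ∧ V = Uᴴ ∧
      B = U * diagonal (fun i => (d i : ℂ)) * V := by
    refine ⟨(hB.eigenvectorUnitary : Matrix n n ℂ), star (hB.eigenvectorUnitary : Matrix n n ℂ),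
      hB.eigenvalues, by simp, rfl, ?_⟩
    have h := hB.spectral_theorem
    rw [Unitary.conjStarAlgAut_apply] at h
    exact h
  have key : ∀ a b : n → ℂ, (U * diagonal a * V) * (U * diagonal b * V)
      = U * diagonal (fun i => a i * b i) * V := by
    intro a b
    calc (U * diagonal a * V) * (U * diagonal b * V)
        = U * diagonal a * (V * U) * diagonal b * V := by simp only [Matrix.mul_assoc]
      _ = U * (diagonal a * diagonal b) * V := by
          rw [hVU, Matrix.mul_one]; simp only [Matrix.mul_assoc]
      _ = _ := by rw [diagonal_mul_diagonal]
  have herm : ∀ a : n → ℝ, (U * diagonal (fun i => (a i : ℂ)) * V).IsHermitian := by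
    intro a
    have hd : (diagonal (fun i => (a i : ℂ)))ᴴ = diagonal (fun i => (a i : ℂ)) := by
      rw [diagonal_conjTranspose]; congr 1; ext i; simp
    unfold Matrix.IsHermitian
    rw [conjTranspose_mul, conjTranspose_mul, hd, hV, conjTranspose_conjTranspose,
      Matrix.mul_assoc]
  refine ⟨U * diagonal (fun i => (((d i)⁻¹ : ℝ) : ℂ)) * V, herm _, ?_⟩
  subst hBd
  constructor
  · rw [key, key]; congr 3; ext i
    by_cases h : d i = 0 <;> simp [h]
  · rw [key, key]; congr 3; ext i
    by_cases h : d i = 0 <;> simp [h]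
  · rw [key]
    have := herm (fun i => d i * (d i)⁻¹)
    simpa using this
  · rw [key]
    have := herm (fun i => (d i)⁻¹ * d i)
    simpa using this

theorem exists_isMoorePenrose {m n : Type*} [Fintype m] [Fintype n] (A : Matrix m n ℂ) :
    ∃ X : Matrix n m ℂ, IsMoorePenrose A X := by
  classical
  obtain ⟨Y, hYh, hY⟩ := exists_isMoorePenrose_of_isHermitian (isHermitian_conjTranspose_mul_self A)
  have hA : A * (Y * (Aᴴ * A)) = A := by
    have h : Aᴴ * (A * (Y * (Aᴴ * A) - 1)) = 0 := by
      have := hY.mul_mul_left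
      rw [← Matrix.mul_assoc, Matrix.mul_sub, ← Matrix.mul_assoc, this, Matrix.mul_one, sub_self]
    rw [← Matrix.mul_assoc, conjTranspose_mul_self_mul_eq_zero, Matrix.mul_sub, Matrix.mul_one,
      sub_eq_zero] at h
    exact h
  refine ⟨Y * Aᴴ, ?_, ?_, ?_, ?_⟩
  · simpa only [Matrix.mul_assoc] using hA
  · have := hY.mul_mul_right
    calc Y * Aᴴ * A * (Y * Aᴴ) = (Y * (Aᴴ * A) * Y) * Aᴴ := by simp only [Matrix.mul_assoc]
      _ = Y * Aᴴ := by rw [this]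
  · unfold Matrix.IsHermitian
    rw [conjTranspose_mul, conjTranspose_mul, conjTranspose_conjTranspose, hYh.eq,
      Matrix.mul_assoc]
  · rw [Matrix.mul_assoc]
    exact hY.isHermitian_right

/-- The Moore-Penrose inverse `A⁺` of a complex matrix. -/
noncomputable def mpInv {m n : Type*} [Fintype m] [Fintype n] (A : Matrix m n ℂ) :
    Matrix n m ℂ :=
  (exists_isMoorePenrose A).choose

theorem mpInv_spec {m n : Type*} [Fintype m] [Fintype n] (A : Matrix m n ℂ) :
    IsMoorePenrose A (mpInv A) :=
  (exists_isMoorePenrose A).choose_spec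

end MoorePenrose

section Transform

/-- The reciprocal sequence: `s_0^♯ = s_0⁺` and
`s_j^♯ = - s_0⁺ * ∑_{l=0}^{j-1} s_{j-l} * s_l^♯` for `j ≥ 1`. -/
noncomputable def reciprocal {p q : ℕ} (s : ℕ → Matrix (Fin p) (Fin q) ℂ) :
    ℕ → Matrix (Fin q) (Fin p) ℂ
  | 0 => mpInv (s 0)
  | j + 1 => -(mpInv (s 0) * ∑ l : Fin (j + 1), s (j + 1 - l) * reciprocal s l)
termination_by j => j
decreasing_by exact l.isLt

/-- The sequence `- α * s_{j-1} + s_j`, with `s_{-1} = 0`. -/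
def plusTransform {p q : ℕ} (α : ℂ) (s : ℕ → Matrix (Fin p) (Fin q) ℂ) :
    ℕ → Matrix (Fin p) (Fin q) ℂ
  | 0 => s 0
  | j + 1 => -(α • s j) + s (j + 1)

/-- The first `α`-Schur-Stieltjes transform: the `j`-th term is
`s_0 * (- u_{j+1}^♯) * s_0` where `u_j = - α * s_{j-1} + s_j`. -/
noncomputable def firstTransform {p q : ℕ} (α : ℂ) (s : ℕ → Matrix (Fin p) (Fin q) ℂ) :
    ℕ → Matrix (Fin p) (Fin q) ℂ :=
  fun j => s 0 * (-(reciprocal (plusTransform α s) (j + 1))) * s 0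

/-- The `k`-th `α`-Schur-Stieltjes transform: the `k`-fold iterate of the first one. If `s` has
length `κ`, then this sequence has length `κ - k`. -/
noncomputable def transform {p q : ℕ} (α : ℂ) :
    ℕ → (ℕ → Matrix (Fin p) (Fin q) ℂ) → (ℕ → Matrix (Fin p) (Fin q) ℂ)
  | 0, s => s
  | k + 1, s => firstTransform α (transform α k s)

end Transform

section Classes

/-- The block Hankel matrix `H_n = [s_{j+k}]_{j,k=0}^n`. -/
def hankel {q : ℕ} (n : ℕ) (s : ℕ → Matrix (Fin q) (Fin q) ℂ) :
    Matrix (Fin (n + 1) × Fin q) (Fin (n + 1) × Fin q) ℂ :=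
  Matrix.of fun a b => s ((a.1 : ℕ) + (b.1 : ℕ)) a.2 b.2

/-- The block column of `s_l, s_{l+1}, …, s_{l+n}`. -/
def blockCol {q : ℕ} (l n : ℕ) (s : ℕ → Matrix (Fin q) (Fin q) ℂ) :
    Matrix (Fin (n + 1) × Fin q) (Fin q) ℂ :=
  Matrix.of fun a b => s (l + (a.1 : ℕ)) a.2 b

/-- The block row of `s_l, s_{l+1}, …, s_{l+n}`. -/
def blockRow {q : ℕ} (l n : ℕ) (s : ℕ → Matrix (Fin q) (Fin q) ℂ) :
    Matrix (Fin q) (Fin (n + 1) × Fin q) ℂ :=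
  Matrix.of fun a b => s (l + (b.1 : ℕ)) a b.2

/-- `L_0 = s_0` and `L_n = s_{2n} - [s_n, …, s_{2n-1}] * H_{n-1}⁺ * col (s_n, …, s_{2n-1})` for
`n ≥ 1`. -/
noncomputable def schurL {q : ℕ} (s : ℕ → Matrix (Fin q) (Fin q) ℂ) :
    ℕ → Matrix (Fin q) (Fin q) ℂ
  | 0 => s 0
  | n + 1 => s (2 * (n + 1)) - blockRow (n + 1) n s * mpInv (hankel n s) * blockCol (n + 1) n s

/-- The right `α`-shifted sequence `a_j = - α * s_j + s_{j+1}`. -/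
def shift {q : ℕ} (α : ℂ) (s : ℕ → Matrix (Fin q) (Fin q) ℂ) :
    ℕ → Matrix (Fin q) (Fin q) ℂ :=
  fun j => -(α • s j) + s (j + 1)

/-- `s_0, …, s_{2n}` is Hankel non-negative definite: `H_n` is non-negative Hermitian. -/
def HankelNonneg {q : ℕ} (n : ℕ) (s : ℕ → Matrix (Fin q) (Fin q) ℂ) : Prop :=
  (hankel n s).PosSemidef

/-- `s_0, …, s_{2n}` is Hankel positive definite: `H_n` is positive Hermitian. -/
def HankelPos {q : ℕ} (n : ℕ) (s : ℕ → Matrix (Fin q) (Fin q) ℂ) : Prop :=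
  (hankel n s).PosDef

/-- `s_0, …, s_{2n}` is Hankel completely degenerate: it is Hankel non-negative definite and
`L_n = 0`. -/
def HankelCd {q : ℕ} (n : ℕ) (s : ℕ → Matrix (Fin q) (Fin q) ℂ) : Prop :=
  HankelNonneg n s ∧ schurL s n = 0

/-- The class `K^≥_{m,α}` for finite `m`. For `m = 2n` with `n ≥ 1` the two conditions are that the
matrices `H_n` of `s` and `H_{n-1}` of the shifted sequence are non-negative Hermitian, and for
`m = 2n+1` that `H_n` of `s` and `H_n` of the shifted sequence are. -/
def KNonnegFin {q : ℕ} (α : ℝ) : ℕ → (ℕ → Matrix (Fin q) (Fin q) ℂ) → Prop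
  | 0, s => HankelNonneg 0 s
  | m + 1, s => HankelNonneg ((m + 1) / 2) s ∧ HankelNonneg (m / 2) (shift (α : ℂ) s)

/-- The class `K^≥_{κ,α}`. -/
def KNonneg {q : ℕ} (α : ℝ) (κ : ℕ∞) (s : ℕ → Matrix (Fin q) (Fin q) ℂ) : Prop :=
  match κ with
  | ⊤ => ∀ m : ℕ, KNonnegFin α m s
  | (m : ℕ) => KNonnegFin α m s

/-- The class `K^{≥,e}_{κ,α}`: for finite `κ = m` there is a matrix `A` such that
`s_0, …, s_m, A` belongs to `K^≥_{m+1,α}`; for `κ = ∞` it is `K^≥_{∞,α}`. -/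
def KNonnegExt {q : ℕ} (α : ℝ) (κ : ℕ∞) (s : ℕ → Matrix (Fin q) (Fin q) ℂ) : Prop :=
  match κ with
  | ⊤ => KNonneg α ⊤ s
  | (m : ℕ) => ∃ A : Matrix (Fin q) (Fin q) ℂ, KNonnegFin α (m + 1) (Function.update s (m + 1) A)

/-- The class `K^>_{m,α}` for finite `m`. -/
def KPosFin {q : ℕ} (α : ℝ) : ℕ → (ℕ → Matrix (Fin q) (Fin q) ℂ) → Prop
  | 0, s => HankelPos 0 s
  | m + 1, s => HankelPos ((m + 1) / 2) s ∧ HankelPos (m / 2) (shift (α : ℂ) s)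

/-- The class `K^>_{κ,α}`. -/
def KPos {q : ℕ} (α : ℝ) (κ : ℕ∞) (s : ℕ → Matrix (Fin q) (Fin q) ℂ) : Prop :=
  match κ with
  | ⊤ => ∀ m : ℕ, KPosFin α m s
  | (m : ℕ) => KPosFin α m s

/-- The class `K^{≥,cd}_{m,α}` for finite `m`: for `m = 2n` the sequence `s_0, …, s_{2n}`, and for
`m = 2n+1` the shifted sequence `a_0, …, a_{2n}`, is Hankel completely degenerate. -/
def KCdFin {q : ℕ} (α : ℝ) (m : ℕ) (s : ℕ → Matrix (Fin q) (Fin q) ℂ) : Prop :=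
  KNonnegFin α m s ∧
    ((Even m → HankelCd (m / 2) s) ∧ (Odd m → HankelCd (m / 2) (shift (α : ℂ) s)))

/-- The class `K^{≥,cd}_{κ,α}`. -/
def KCd {q : ℕ} (α : ℝ) (κ : ℕ∞) (s : ℕ → Matrix (Fin q) (Fin q) ℂ) : Prop :=
  match κ with
  | ⊤ => KNonneg α ⊤ s ∧ ∃ m : ℕ, KCdFin α m s
  | (m : ℕ) => KCdFin α m s

/-- The class `K^{≥,cd,m}_{κ,α}` of those members of `K^≥_{κ,α}` whose initial section
`s_0, …, s_m` belongs to `K^{≥,cd}_{m,α}`. -/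
def KCdOrder {q : ℕ} (α : ℝ) (m : ℕ) (κ : ℕ∞) (s : ℕ → Matrix (Fin q) (Fin q) ℂ) : Prop :=
  KNonneg α κ s ∧ KCdFin α m s

end Classes

end SchurStieltjes

/-! Write `s(X) = ∑ s_j X^j` and let `r(X)` be the series of the reciprocal sequence. When the `s_j`
are Hermitian, `r` is a two-sided inverse of `s` in the corner cut out by the projection
`e = s_0 s_0⁺`. Widom's identity `H(fg) = T(f) H(g) + H(f) T(g)ᵀ` for Toeplitz and Hankel matrices,
applied to such an inverse pair, turns the Hankel matrix of the one series into that of the other by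
a congruence with the lower triangular Toeplitz matrix `T(r)`. Since the transform is a reciprocal
multiplied by `s_0` from both sides, this makes the block Hankel matrix of `s^[1,α]` congruent to
that of the shifted sequence `a`, and the block Hankel matrix of the shift of `s^[1,α]` congruent to
that of `s` up to the removal of a first block row and column. Congruence preserves (positive)
definiteness. It also preserves complete degeneracy: for a non-negative Hermitian block Hankel
matrix, `L_n = 0` says that the matrix annihilates a block column whose last block is the identity,
and the Toeplitz factor has a Toeplitz matrix with unit diagonal as a left inverse in the corner,
whose adjoint maps such columns to such columns. -/

namespace SchurStieltjes

open Matrix Finset PowerSeries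
open scoped ComplexOrder

section CornerInverse

/-- `u` and `r` are inverse to each other relative to the idempotent `e`, where `r` lies in the
corner `e M e` but `u` need not: `r` is then the inverse of `e u e` in that corner. -/
structure IsCornerInverse {M : Type*} [Semigroup M] (e u r : M) : Prop where
  left_mul : e * r = r
  mul_right : r * e = r
  mul_mul_left : e * u * r = e
  mul_mul_right : r * u * e = e

variable {M : Type*} [Semigroup M] {e u r : M}

theorem corner_left_inv_eq_right_inv {l : M} (hl : l * e = l) (hlu : l * u * e = e)
    (hr : e * r = r) (hur : e * u * r = e) : l = r :=
  calc l = l * (e * u * r) := by rw [hur, hl]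
    _ = l * u * (e * r) := by rw [hr, ← mul_assoc, ← mul_assoc, hl]
    _ = r := by rw [← mul_assoc, hlu, hr]

theorem IsCornerInverse.of_mul_central {z : M} (hz : ∀ f, Commute z f)
    (h : IsCornerInverse e (z * u) r) : IsCornerInverse e u (z * r) where
  left_mul := by rw [← mul_assoc, ← (hz e).eq, mul_assoc, h.left_mul]
  mul_right := by rw [mul_assoc, h.mul_right]
  mul_mul_left := by rw [← mul_assoc, mul_assoc e u z, ← (hz u).eq, h.mul_mul_left]
  mul_mul_right := by rw [(hz r).eq, mul_assoc r z u, h.mul_mul_right]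

end CornerInverse

section StarSeries

variable {R : Type*} [Semiring R] [StarRing R]

/-- The power series with the adjoint coefficients. -/
noncomputable def starSeries (f : R⟦X⟧) : R⟦X⟧ := PowerSeries.mk fun j => star (coeff j f)

theorem starSeries_mul (f g : R⟦X⟧) : starSeries (f * g) = starSeries g * starSeries f := by
  ext j
  simp only [starSeries, coeff_mk, coeff_mul, star_sum, star_mul]
  exact Nat.sum_antidiagonal_swap
    (f := fun p : ℕ × ℕ => star (coeff p.1 g) * star (coeff p.2 f))

theorem starSeries_C (a : R) : starSeries (C a) = C (star a) := by
  ext j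
  rw [starSeries, coeff_mk, coeff_C, coeff_C, apply_ite star, star_zero]

theorem starSeries_eq_of_corner_right_inv {e u r : R⟦X⟧} (he : starSeries e = e)
    (hu : starSeries u = u) (hr : e * r = r) (hur : e * u * r = e) : starSeries r = r := by
  refine corner_left_inv_eq_right_inv (e := e) (u := u) ?_ ?_ hr hur
  · conv_rhs => rw [← hr, starSeries_mul, he]
  · conv_rhs => rw [← he, ← hur, mul_assoc, starSeries_mul, starSeries_mul, he, hu]

theorem IsCornerInverse.of_right_inv {e u r : R⟦X⟧} (he : starSeries e = e)
    (hu : starSeries u = u) (hr : e * r = r) (hur : e * u * r = e) : IsCornerInverse e u r := by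
  have hstar : starSeries r = r := starSeries_eq_of_corner_right_inv he hu hr hur
  refine ⟨hr, ?_, hur, ?_⟩
  · conv_rhs => rw [← hstar, ← hr, starSeries_mul, he, hstar]
  · conv_rhs => rw [← he, ← hur, mul_assoc, starSeries_mul, starSeries_mul, he, hu, hstar]

end StarSeries

section Toeplitz

variable {R : Type*} [Semiring R]

/-- The lower triangular Toeplitz matrix `[f_{i-j}]`, written as the matrix of multiplication by
`f` modulo `X ^ (n + 1)`. -/
noncomputable def toeplitz (n : ℕ) (f : R⟦X⟧) : Matrix (Fin (n + 1)) (Fin (n + 1)) R :=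
  Matrix.of fun i j => coeff (i : ℕ) (X ^ (j : ℕ) * f)

/-- The Hankel matrix `[h_{i+j}]` with entries in a ring; for matrix entries this is
`SchurStieltjes.hankel` before flattening the blocks. -/
def hankelMatrix (n : ℕ) (h : ℕ → R) : Matrix (Fin (n + 1)) (Fin (n + 1)) R :=
  Matrix.of fun i j => h (i + j)

theorem sum_toeplitz {A : Type*} [AddCommMonoid A] {n : ℕ} (f : R⟦X⟧) (i : Fin (n + 1))
    (φ : R → ℕ → A) (hφ : ∀ a, φ 0 a = 0) :
    ∑ a, φ (toeplitz n f i a) a = ∑ p ∈ antidiagonal (i : ℕ), φ (coeff p.1 f) p.2 := by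
  rw [← Nat.sum_antidiagonal_swap, Nat.sum_antidiagonal_eq_sum_range_succ_mk]
  have entry (a : ℕ) : φ (coeff (i : ℕ) (X ^ a * f)) a =
      if a ∈ Finset.range (i + 1) then φ (coeff (i - a) f) a else 0 := by
    simp only [coeff_X_pow_mul', Finset.mem_range, Nat.lt_succ_iff]
    split_ifs
    · rfl
    · exact hφ a
  calc ∑ a, φ (toeplitz n f i a) a
      = ∑ a ∈ Finset.range (n + 1), φ (coeff (i : ℕ) (X ^ a * f)) a :=
        Fin.sum_univ_eq_sum_range (fun a => φ (coeff (i : ℕ) (X ^ a * f)) a) (n + 1)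
    _ = ∑ a ∈ Finset.range (i + 1), φ (coeff (i - a) f) a := by
        simp only [entry]
        rw [Finset.sum_ite_mem, Finset.inter_eq_right.2 (Finset.range_subset_range.2 i.isLt)]

theorem toeplitz_mul (n : ℕ) (f g : R⟦X⟧) : toeplitz n (f * g) = toeplitz n f * toeplitz n g := by
  ext i k
  have hcomm : X ^ (k : ℕ) * (f * g) = f * (X ^ (k : ℕ) * g) := by
    rw [← mul_assoc, ((commute_X f).pow_right k).eq.symm, mul_assoc]
  rw [Matrix.mul_apply, toeplitz, Matrix.of_apply, hcomm, coeff_mul]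
  exact (sum_toeplitz f i (fun x a => x * coeff a (X ^ (k : ℕ) * g)) fun _ => zero_mul _).symm

theorem toeplitz_C (n : ℕ) (a : R) : toeplitz n (C a) = Matrix.diagonal fun _ => a := by
  ext i j
  rw [toeplitz, Matrix.of_apply, coeff_X_pow_mul', Matrix.diagonal_apply, coeff_C]
  grind

theorem toeplitz_one (n : ℕ) : toeplitz n (1 : R⟦X⟧) = 1 := by
  rw [← map_one C, toeplitz_C, diagonal_one]

theorem conjTranspose_toeplitz [StarRing R] (n : ℕ) (f : R⟦X⟧) :
    (toeplitz n f)ᴴ = (toeplitz n (starSeries f))ᵀ := by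
  ext i j
  simp only [toeplitz, starSeries, conjTranspose_apply, transpose_apply, Matrix.of_apply,
    coeff_X_pow_mul', coeff_mk, apply_ite star, star_zero]

theorem toeplitz_mul_hankelMatrix_apply {n : ℕ} (f : R⟦X⟧) (h : ℕ → R) (i k : Fin (n + 1)) :
    (toeplitz n f * hankelMatrix n h) i k =
      coeff (i : ℕ) (f * PowerSeries.mk fun a => h (a + k)) := by
  simp only [coeff_mul, coeff_mk]
  exact sum_toeplitz f i (fun x a => x * h (a + k)) fun _ => zero_mul _

/-- Widom's identity. -/
theorem hankelMatrix_mul (n : ℕ) (f g : R⟦X⟧) :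
    hankelMatrix n (fun j => coeff (j + 1) (f * g)) =
      toeplitz n f * hankelMatrix n (fun j => coeff (j + 1) g) +
        hankelMatrix n (fun j => coeff (j + 1) f) * (toeplitz n g)ᵀ := by
  ext i k
  have left : (toeplitz n f * hankelMatrix n (fun j => coeff (j + 1) g)) i k =
      ∑ p ∈ antidiagonal (i : ℕ), coeff p.1 f * coeff (p.2 + k + 1) g := by
    simp only [toeplitz_mul_hankelMatrix_apply, coeff_mul, coeff_mk]
  have right : (hankelMatrix n (fun j => coeff (j + 1) f) * (toeplitz n g)ᵀ) i k =
      ∑ p ∈ antidiagonal (k : ℕ), coeff (i + p.2 + 1) f * coeff p.1 g :=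
    sum_toeplitz g k (fun x a => coeff (i + a + 1) f * x) fun _ => mul_zero _
  rw [Matrix.add_apply, left, right, ← Nat.sum_antidiagonal_swap (n := (k : ℕ)),
    hankelMatrix, Matrix.of_apply, coeff_mul]
  simp only [Nat.sum_antidiagonal_eq_sum_range_succ_mk, Prod.swap]
  rw [show ((i : ℕ) + k + 1).succ = (i + 1) + (k + 1) by omega, Finset.sum_range_add]
  refine congrArg₂ _ (Finset.sum_congr rfl fun p hp => ?_) (Finset.sum_congr rfl fun p _ => ?_)
  · rw [show (i : ℕ) + k + 1 - p = i - p + k + 1 by grind]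
  · rw [show (i : ℕ) + k + 1 - (i + 1 + p) = k - p by grind,
      show (i : ℕ) + 1 + p = i + p + 1 by omega]

theorem hankelMatrix_coeff_succ_C (n : ℕ) (a : R) :
    hankelMatrix n (fun j => coeff (j + 1) (C a)) = 0 := by
  ext i k
  simp [hankelMatrix]

end Toeplitz

section CornerHankel

variable {R : Type*} [Ring R] {e : R} {u r : R⟦X⟧}

theorem toeplitz_C_mul_hankelMatrix (n : ℕ) (a : R) (f : R⟦X⟧) :
    toeplitz n (C a) * hankelMatrix n (fun j => coeff (j + 1) f) =
      hankelMatrix n fun j => coeff (j + 1) (C a * f) := by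
  rw [hankelMatrix_mul, hankelMatrix_coeff_succ_C, Matrix.zero_mul, add_zero]

theorem IsCornerInverse.toeplitz_mul_hankelMatrix_mul (h : IsCornerInverse (C e) u r) {z : R⟦X⟧}
    (hz : ∀ f, Commute z f) (n : ℕ) :
    toeplitz n r * hankelMatrix n (fun j => coeff (j + 1) (z * u)) * (toeplitz n r)ᵀ =
      toeplitz n r * hankelMatrix n (fun j => coeff (j + 1) (z * C e)) -
        toeplitz n z * hankelMatrix n (fun j => coeff (j + 1) r) := by
  have hzur : C e * (z * u * r) = z * C e := by
    rw [← mul_assoc, ← mul_assoc, ← (hz _).eq, mul_assoc z, mul_assoc z, h.mul_mul_left]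
  have hrzu : r * (z * u * C e) = z * C e := by
    rw [mul_assoc, ← mul_assoc, ← (hz r).eq, mul_assoc, ← mul_assoc r, h.mul_mul_right]
  have product : toeplitz n r * hankelMatrix n (fun j => coeff (j + 1) (z * u * r)) =
      toeplitz n r * hankelMatrix n (fun j => coeff (j + 1) (z * C e)) := by
    rw [← hzur, ← toeplitz_C_mul_hankelMatrix, ← Matrix.mul_assoc, ← toeplitz_mul, h.mul_right]
  have left : toeplitz n r *
      (toeplitz n (z * u) * hankelMatrix n (fun j => coeff (j + 1) r)) =
        toeplitz n z * hankelMatrix n (fun j => coeff (j + 1) r) := by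
    conv_lhs => rw [← h.left_mul, ← toeplitz_C_mul_hankelMatrix]
    simp only [← Matrix.mul_assoc, ← toeplitz_mul]
    rw [h.left_mul, hrzu, toeplitz_mul, Matrix.mul_assoc, toeplitz_C_mul_hankelMatrix, h.left_mul]
  rw [← product, hankelMatrix_mul n (z * u), Matrix.mul_add, left, Matrix.mul_assoc,
    add_sub_cancel_left]

theorem IsCornerInverse.toeplitz_mul_hankelMatrix_succ_mul (h : IsCornerInverse (C e) u r)
    (n : ℕ) :
    toeplitz n r * hankelMatrix n (fun j => coeff (j + 1) u) * (toeplitz n r)ᵀ =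
      hankelMatrix n fun j => -coeff (j + 1) r := by
  have key := h.toeplitz_mul_hankelMatrix_mul Commute.one_left n
  rw [one_mul, one_mul, hankelMatrix_coeff_succ_C, Matrix.mul_zero, zero_sub, toeplitz_one,
    Matrix.one_mul] at key
  rw [key]
  rfl

theorem IsCornerInverse.toeplitz_mul_hankelMatrix_mul_apply (h : IsCornerInverse (C e) u r)
    {n : ℕ} (i k : Fin (n + 1)) :
    (toeplitz n r * hankelMatrix n (fun j => coeff j u) * (toeplitz n r)ᵀ) i k =
      coeff (i : ℕ) (r * PowerSeries.mk fun a => coeff (a + k) (C e)) -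
        coeff (i : ℕ) (X * PowerSeries.mk fun a => coeff (a + k + 1) r) := by
  have key := h.toeplitz_mul_hankelMatrix_mul (z := X) (fun f => (commute_X f).symm) n
  simp only [coeff_succ_X_mul] at key
  rw [key, Matrix.sub_apply, toeplitz_mul_hankelMatrix_apply, toeplitz_mul_hankelMatrix_apply]

theorem IsCornerInverse.toeplitz_mul_hankelMatrix_mul_succ_zero (h : IsCornerInverse (C e) u r)
    {n : ℕ} (i : Fin (n + 1)) :
    (toeplitz (n + 1) r * hankelMatrix (n + 1) (fun j => coeff j u) * (toeplitz (n + 1) r)ᵀ)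
      i.succ 0 = 0 := by
  have hCe : (PowerSeries.mk fun a => coeff (a + 0) (C e)) = C e := PowerSeries.ext fun j => by simp
  rw [h.toeplitz_mul_hankelMatrix_mul_apply, Fin.val_succ, coeff_succ_X_mul, coeff_mk,
    Fin.val_zero, hCe, h.mul_right, sub_self]

theorem IsCornerInverse.toeplitz_mul_hankelMatrix_mul_submatrix (h : IsCornerInverse (C e) u r)
    (n : ℕ) :
    (toeplitz (n + 1) r * hankelMatrix (n + 1) (fun j => coeff j u) *
      (toeplitz (n + 1) r)ᵀ).submatrix Fin.succ Fin.succ =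
        hankelMatrix n fun j => -coeff (j + 2) r := by
  ext i k
  have hCe : (PowerSeries.mk fun a => coeff (a + k.succ) (C e)) = 0 :=
    PowerSeries.ext fun j => by simp [coeff_C]
  rw [submatrix_apply, h.toeplitz_mul_hankelMatrix_mul_apply, hCe, mul_zero, map_zero, zero_sub,
    Fin.val_succ, coeff_succ_X_mul, coeff_mk]
  rfl

theorem toeplitz_C_mul_mul_toeplitz_C_transpose_apply {n : ℕ} (c : R)
    (M : Matrix (Fin (n + 1)) (Fin (n + 1)) R) (i j : Fin (n + 1)) :
    (toeplitz n (C c) * M * (toeplitz n (C c))ᵀ) i j = c * M i j * c := by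
  rw [toeplitz_C, diagonal_transpose, mul_diagonal, diagonal_mul]

variable [StarRing R] {c : R}

theorem mul_conjTranspose_toeplitz_C_mul {n : ℕ} (hc : star c = c) (hr : starSeries r = r)
    (M : Matrix (Fin (n + 1)) (Fin (n + 1)) R) :
    toeplitz n (C c * r) * M * (toeplitz n (C c * r))ᴴ =
      toeplitz n (C c) * (toeplitz n r * M * (toeplitz n r)ᵀ) * (toeplitz n (C c))ᵀ := by
  have hTr : (toeplitz n r)ᴴ = (toeplitz n r)ᵀ := by rw [conjTranspose_toeplitz, hr]
  have hTc : (toeplitz n (C c))ᴴ = (toeplitz n (C c))ᵀ := by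
    rw [conjTranspose_toeplitz, starSeries_C, hc]
  rw [toeplitz_mul, conjTranspose_mul, hTr, hTc]
  simp only [Matrix.mul_assoc]

theorem IsCornerInverse.toeplitz_congruence (h : IsCornerInverse (C e) u r) (hc : star c = c)
    (hr : starSeries r = r) (n : ℕ) :
    toeplitz n (C c * r) * hankelMatrix n (fun j => coeff (j + 1) u) * (toeplitz n (C c * r))ᴴ =
      hankelMatrix n fun j => c * -coeff (j + 1) r * c := by
  rw [mul_conjTranspose_toeplitz_C_mul hc hr, h.toeplitz_mul_hankelMatrix_succ_mul]
  ext i j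
  rw [toeplitz_C_mul_mul_toeplitz_C_transpose_apply]
  rfl

end CornerHankel

section MonicKernel

variable {R : Type*} [Ring R]

theorem IsCornerInverse.exists_monic_left_inverse {c d e : R} {u r : R⟦X⟧}
    (h : IsCornerInverse (C e) u r) (hu : coeff 0 u = c) (hdc : d * c = e) (hcd : c * d = e)
    (hec : e * c = c) : ∃ g : R⟦X⟧, g * (C c * r) = C e ∧ coeff 0 g = 1 := by
  refine ⟨C e * u * C d + (1 - C e), ?_, ?_⟩
  · have hdcr : C d * (C c * r) = r := by rw [← mul_assoc, ← map_mul, hdc, h.left_mul]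
    have hecr : C e * (C c * r) = C c * r := by rw [← mul_assoc, ← map_mul, hec]
    rw [add_mul, sub_mul, mul_assoc, hdcr, h.mul_mul_left, one_mul, hecr, sub_self, add_zero]
  · have hu' : constantCoeff u = c := by rw [← coeff_zero_eq_constantCoeff_apply, hu]
    simp only [coeff_zero_eq_constantCoeff, map_add, map_sub, map_mul, map_one, constantCoeff_C,
      hu', hec, hcd, add_sub_cancel]

/-- `K` annihilates a vector with last entry `1`. If `K` is a Hankel matrix `[s_{i+j}]`, the entries
of this vector are the coefficients of a monic polynomial of degree `n` which is orthogonal to all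
polynomials of degree at most `n`, and this is complete degeneracy. -/
def HasMonicKernel {n : ℕ} (K : Matrix (Fin (n + 1)) (Fin (n + 1)) R) : Prop :=
  ∃ Y, K *ᵥ Y = 0 ∧ Y (Fin.last n) = 1

theorem HasMonicKernel.submatrix_succ {n : ℕ} {K : Matrix (Fin (n + 2)) (Fin (n + 2)) R}
    (hK : HasMonicKernel K) (h : ∀ i : Fin (n + 1), K i.succ 0 = 0) :
    HasMonicKernel (K.submatrix Fin.succ Fin.succ) := by
  obtain ⟨Y, hY, hlast⟩ := hK
  refine ⟨fun i => Y i.succ, ?_, hlast⟩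
  ext i
  have hi := congrFun hY i.succ
  simpa [Matrix.mulVec, dotProduct, Fin.sum_univ_succ, h] using hi

theorem HasMonicKernel.toeplitz_congr [StarRing R] {n : ℕ} {e : R} {f g : R⟦X⟧}
    {K : Matrix (Fin (n + 1)) (Fin (n + 1)) R} (hK : HasMonicKernel K) (hgf : g * f = C e)
    (hg : coeff 0 g = 1) (he : star e = e) (hKe : K * toeplitz n (C e) = K) :
    HasMonicKernel (toeplitz n f * K * (toeplitz n f)ᴴ) := by
  obtain ⟨Y, hY, hlast⟩ := hK
  have hfg : (toeplitz n f)ᴴ * (toeplitz n g)ᴴ = toeplitz n (C e) := by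
    rw [← conjTranspose_mul, ← toeplitz_mul, hgf, conjTranspose_toeplitz, starSeries_C, he,
      toeplitz_C, diagonal_transpose]
  refine ⟨(toeplitz n g)ᴴ *ᵥ Y, ?_, ?_⟩
  · rw [Matrix.mulVec_mulVec, Matrix.mul_assoc, hfg, Matrix.mul_assoc, hKe, ← Matrix.mulVec_mulVec,
      hY, Matrix.mulVec_zero]
  · have entry (a : Fin (n + 1)) :
        toeplitz n g a (Fin.last n) = if a = Fin.last n then 1 else 0 := by
      rw [toeplitz, Matrix.of_apply, coeff_X_pow_mul', Fin.val_last]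
      grind
    simp [Matrix.mulVec, dotProduct, entry, apply_ite star, hlast]

end MonicKernel

section MoorePenrose

variable {m n : Type*} [Fintype m] [Fintype n]

theorem IsMoorePenrose.conjTranspose {A : Matrix m n ℂ} {X : Matrix n m ℂ}
    (h : IsMoorePenrose A X) : IsMoorePenrose Aᴴ Xᴴ where
  mul_mul_left := by
    rw [← conjTranspose_mul, ← conjTranspose_mul, ← Matrix.mul_assoc, h.mul_mul_left]
  mul_mul_right := by
    rw [← conjTranspose_mul, ← conjTranspose_mul, ← Matrix.mul_assoc, h.mul_mul_right]
  isHermitian_left := by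
    rw [← conjTranspose_mul]
    exact h.isHermitian_right.conjTranspose
  isHermitian_right := by
    rw [← conjTranspose_mul]
    exact h.isHermitian_left.conjTranspose

theorem mpInv_conjTranspose (A : Matrix m n ℂ) : mpInv Aᴴ = (mpInv A)ᴴ :=
  (mpInv_spec Aᴴ).unique (mpInv_spec A).conjTranspose

theorem mul_mpInv_comm {A : Matrix n n ℂ} (hA : A.IsHermitian) : mpInv A * A = A * mpInv A := by
  have hX : (mpInv A)ᴴ = mpInv A := by rw [← mpInv_conjTranspose, hA.eq]
  rw [← (mpInv_spec A).isHermitian_left.eq, conjTranspose_mul, hA.eq, hX]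

end MoorePenrose

section PosSemidef

variable {𝕜 m n l : Type*} [RCLike 𝕜] [Fintype m]

theorem mul_eq_zero_of_conjTranspose_mul_mul {M : Matrix m m 𝕜} (hM : M.PosSemidef)
    {Y : Matrix m l 𝕜} (h : Yᴴ * (M * Y) = 0) : M * Y = 0 := by
  ext i j
  have hj : star (Y.col j) ⬝ᵥ (M *ᵥ Y.col j) = 0 := congrFun₂ h j j
  exact congrFun ((hM.dotProduct_mulVec_zero_iff _).1 hj) i

theorem mul_eq_zero_of_fromBlocks [Finite n] {A : Matrix m m 𝕜} {B : Matrix m n 𝕜}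
    {B' : Matrix n m 𝕜} {D : Matrix n n 𝕜} (hM : (fromBlocks A B B' D).PosSemidef)
    {Y : Matrix m l 𝕜} (h : A * Y = 0) : B' * Y = 0 := by
  have := Fintype.ofFinite n
  have hMY : fromBlocks A B B' D * fromRows Y (0 : Matrix n l 𝕜) = fromRows 0 (B' * Y) := by
    simp only [fromBlocks_mul_fromRows, h, Matrix.mul_zero, add_zero]
  have hzero := mul_eq_zero_of_conjTranspose_mul_mul hM (Y := fromRows Y (0 : Matrix n l 𝕜)) (by
    rw [hMY, conjTranspose_fromRows_eq_fromCols_conjTranspose, fromCols_mul_fromRows]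
    simp only [conjTranspose_zero, Matrix.mul_zero, Matrix.zero_mul, add_zero])
  rw [hMY, ← fromRows_zero, fromRows_ext_iff] at hzero
  exact hzero.2

theorem schurComplement_eq_zero_iff [Fintype n] [DecidableEq n] {A : Matrix m m ℂ}
    {B : Matrix m n ℂ} {B' : Matrix n m ℂ} {D : Matrix n n ℂ}
    (hM : (fromBlocks A B B' D).PosSemidef) :
    D - B' * mpInv A * B = 0 ↔
      ∃ W : Matrix m n ℂ, fromBlocks A B B' D * fromRows W (1 : Matrix n n ℂ) = 0 := by
  classical
  obtain ⟨hA, hB, -, -⟩ := isHermitian_fromBlocks_iff.1 hM.isHermitian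
  have rowRange : B' * (mpInv A * A) = B' := by
    have h := mul_eq_zero_of_fromBlocks hM (Y := 1 - mpInv A * A) (by
      rw [Matrix.mul_sub, ← Matrix.mul_assoc, (mpInv_spec A).mul_mul_left, Matrix.mul_one,
        sub_self])
    rwa [Matrix.mul_sub, Matrix.mul_one, sub_eq_zero, eq_comm] at h
  have colRange : A * mpInv A * B = B := by
    have h := congrArg conjTranspose rowRange
    rwa [conjTranspose_mul, (mpInv_spec A).isHermitian_right.eq, mul_mpInv_comm hA, ← hB,
      conjTranspose_conjTranspose] at h
  simp only [fromBlocks_mul_fromRows, Matrix.mul_one, ← fromRows_zero, fromRows_ext_iff]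
  constructor
  · refine fun h => ⟨-(mpInv A * B), ?_, ?_⟩
    · rw [Matrix.mul_neg, ← Matrix.mul_assoc, colRange, neg_add_cancel]
    · rw [Matrix.mul_neg, ← Matrix.mul_assoc, neg_add_eq_sub, h]
  · rintro ⟨W, hB', hD⟩
    rw [eq_neg_of_add_eq_zero_right hB', Matrix.mul_neg, ← Matrix.mul_assoc,
      Matrix.mul_assoc B', rowRange, sub_neg_eq_add, add_comm, hD]

end PosSemidef

section BlockHankel

variable {q : ℕ} {s : ℕ → Matrix (Fin q) (Fin q) ℂ}

theorem compRingEquiv_hankelMatrix (n : ℕ) (s : ℕ → Matrix (Fin q) (Fin q) ℂ) :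
    compRingEquiv (Fin (n + 1)) (Fin q) ℂ (hankelMatrix n s) = hankel n s :=
  rfl

theorem HankelNonneg.mono {m n : ℕ} (hmn : m ≤ n) (h : HankelNonneg n s) : HankelNonneg m s :=
  PosSemidef.submatrix h fun a : Fin (m + 1) × Fin q => (a.1.castLE (Nat.succ_le_succ hmn), a.2)

theorem HankelPos.mono {m n : ℕ} (hmn : m ≤ n) (h : HankelPos n s) : HankelPos m s :=
  PosDef.submatrix h (e := Prod.map (Fin.castLE (Nat.succ_le_succ hmn)) id)
    ((Fin.castLE_injective _).prodMap Function.injective_id)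

theorem HankelNonneg.isHermitian {n j : ℕ} (h : HankelNonneg n s) (hj : j ≤ 2 * n) :
    (s j).IsHermitian := by
  obtain ⟨a, b, ha, hb, rfl⟩ : ∃ a b, a ≤ n ∧ b ≤ n ∧ b + a = j :=
    ⟨min j n, j - min j n, by omega, by omega, by omega⟩
  ext i k
  have entry := PosSemidef.isHermitian h |>.apply
    ((⟨a, by omega⟩ : Fin (n + 1)), i) ((⟨b, by omega⟩ : Fin (n + 1)), k)
  simpa [hankel, add_comm a b] using entry

theorem HankelNonneg.mul_eq_zero {n i l : ℕ} (h : HankelNonneg n s) (hi : i ≤ n) (hl : l ≤ n)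
    {Q : Matrix (Fin q) (Fin q) ℂ} (hQ : s (i + i) * Q = 0) : s (l + i) * Q = 0 := by
  let e : Fin q ⊕ Fin q → Fin (n + 1) × Fin q :=
    Sum.elim (Prod.mk ⟨i, by omega⟩) (Prod.mk ⟨l, by omega⟩)
  have blocks : (hankel n s).submatrix e e =
      fromBlocks (s (i + i)) (s (i + l)) (s (l + i)) (s (l + l)) := by
    ext (a | a) (b | b) <;> rfl
  refine mul_eq_zero_of_fromBlocks (B := s (i + l)) (D := s (l + l)) ?_ hQ
  rw [← blocks]
  exact PosSemidef.submatrix h e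

/-- A column of blocks, flattened in the same way as `Matrix.comp` flattens a block matrix. -/
def blockVec {ι : Type*} (Y : ι → Matrix (Fin q) (Fin q) ℂ) : Matrix (ι × Fin q) (Fin q) ℂ :=
  Matrix.of fun a => Y a.1 a.2

theorem compRingEquiv_mul_blockVec {ι : Type*} [Fintype ι]
    (M : Matrix ι ι (Matrix (Fin q) (Fin q) ℂ)) (Y : ι → Matrix (Fin q) (Fin q) ℂ) :
    compRingEquiv ι (Fin q) ℂ M * blockVec Y = blockVec (M *ᵥ Y) := by
  ext a b
  simp [Matrix.mul_apply, Fintype.sum_prod_type, blockVec, Matrix.mulVec, dotProduct,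
    Matrix.sum_apply]

/-- Splits off the last block of the index set of `hankel (n + 1) s`. -/
noncomputable def lastBlockEquiv (n q : ℕ) :
    (Fin (n + 1) × Fin q) ⊕ Fin q ≃ Fin (n + 2) × Fin q :=
  Equiv.ofBijective (Sum.elim (Prod.map Fin.castSucc id) (Prod.mk (Fin.last (n + 1)))) <| by
    refine ⟨?_, ?_⟩
    · refine ((Fin.castSucc_injective _).prodMap Function.injective_id).sumElim
        (Prod.mk_right_injective _) fun i b h => ?_
      exact (Fin.castSucc_lt_last i.1).ne (congrArg Prod.fst h)
    · rintro ⟨i, a⟩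
      induction i using Fin.lastCases with
      | last => exact ⟨.inr a, rfl⟩
      | cast i => exact ⟨.inl (i, a), rfl⟩

theorem hankel_submatrix_lastBlockEquiv (n : ℕ) (s : ℕ → Matrix (Fin q) (Fin q) ℂ) :
    (hankel (n + 1) s).submatrix (lastBlockEquiv n q) (lastBlockEquiv n q) =
      fromBlocks (hankel n s) (blockCol (n + 1) n s) (blockRow (n + 1) n s) (s (2 * (n + 1))) := by
  ext (a | a) (b | b)
  · rfl
  · exact congrFun₂ (congrArg s (add_comm _ _)) a.2 b
  · rfl
  · exact congrFun₂ (congrArg s (two_mul _).symm) a b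

theorem blockVec_submatrix_lastBlockEquiv {n : ℕ} (Y : Fin (n + 2) → Matrix (Fin q) (Fin q) ℂ) :
    (blockVec Y).submatrix (lastBlockEquiv n q) id =
      fromRows (blockVec fun i : Fin (n + 1) => Y i.castSucc) (Y (Fin.last _)) := by
  ext (a | a) b <;> rfl

theorem hankelMatrix_mulVec_eq_zero_iff {n : ℕ} (Y : Fin (n + 2) → Matrix (Fin q) (Fin q) ℂ) :
    hankelMatrix (n + 1) s *ᵥ Y = 0 ↔
      fromBlocks (hankel n s) (blockCol (n + 1) n s) (blockRow (n + 1) n s) (s (2 * (n + 1))) *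
        fromRows (blockVec fun i : Fin (n + 1) => Y i.castSucc) (Y (Fin.last _)) = 0 := by
  rw [← hankel_submatrix_lastBlockEquiv, ← blockVec_submatrix_lastBlockEquiv,
    submatrix_mul_equiv, ← compRingEquiv_hankelMatrix, compRingEquiv_mul_blockVec]
  refine ⟨fun h => by rw [h]; rfl, fun h => ?_⟩
  ext i a b
  simpa [blockVec] using congrFun₂ h ((lastBlockEquiv n q).symm (i, a)) b

theorem schurL_eq_zero_iff {n : ℕ} (h : HankelNonneg n s) :
    schurL s n = 0 ↔ HasMonicKernel (hankelMatrix n s) := by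
  cases n with
  | zero =>
    have single (Y : Fin 1 → Matrix (Fin q) (Fin q) ℂ) (hY : Y (Fin.last 0) = 1) :
        (hankelMatrix 0 s *ᵥ Y) 0 = s 0 := by
      rw [Matrix.mulVec, dotProduct, Fin.sum_univ_one, show Y 0 = 1 from hY, mul_one]
      rfl
    refine ⟨fun h0 => ⟨1, ?_, rfl⟩, fun ⟨Y, hY, hlast⟩ => ?_⟩
    · ext1 i
      rw [Fin.fin_one_eq_zero i, single 1 rfl]
      exact h0
    · rw [schurL, ← single Y hlast, hY, Pi.zero_apply]
  | succ n =>
    have hblocks := PosSemidef.submatrix h (lastBlockEquiv n q)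
    rw [hankel_submatrix_lastBlockEquiv] at hblocks
    rw [schurL, schurComplement_eq_zero_iff hblocks]
    constructor
    · rintro ⟨W, hW⟩
      let Y : Fin (n + 2) → Matrix (Fin q) (Fin q) ℂ :=
        Fin.snoc (fun i => Matrix.of fun a => W (i, a)) 1
      have hYW : (blockVec fun i : Fin (n + 1) => Y i.castSucc) = W := by
        ext a b
        simp [blockVec, Y]
      have hlast : Y (Fin.last _) = 1 := Fin.snoc_last _ _
      exact ⟨Y, (hankelMatrix_mulVec_eq_zero_iff Y).2 (by rw [hYW, hlast, hW]), hlast⟩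
    · rintro ⟨Y, hY, hlast⟩
      rw [hankelMatrix_mulVec_eq_zero_iff, hlast] at hY
      exact ⟨_, hY⟩

theorem mul_eq_self_of_schurL_eq_zero {n : ℕ} {e : Matrix (Fin q) (Fin q) ℂ} (h : schurL s n = 0)
    (he : ∀ j < 2 * n, s j * e = s j) (j : ℕ) (hj : j ≤ 2 * n) : s j * e = s j := by
  rcases hj.lt_or_eq with hlt | rfl
  · exact he j hlt
  cases n with
  | zero =>
    have h0 : s 0 = 0 := h
    rw [Nat.mul_zero, h0, Matrix.zero_mul]
  | succ n =>
    have hcol : blockCol (n + 1) n s * e = blockCol (n + 1) n s := by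
      ext a b
      exact congrFun₂ (he (n + 1 + a.1) (by omega)) a.2 b
    rw [schurL, sub_eq_zero] at h
    rw [h, Matrix.mul_assoc, hcol]

end BlockHankel

section Reciprocal

theorem reciprocal_zero {p q : ℕ} (s : ℕ → Matrix (Fin p) (Fin q) ℂ) :
    reciprocal s 0 = mpInv (s 0) := by
  rw [reciprocal]

theorem reciprocal_succ {p q : ℕ} (s : ℕ → Matrix (Fin p) (Fin q) ℂ) (j : ℕ) :
    reciprocal s (j + 1) =
      -(mpInv (s 0) * ∑ l ∈ Finset.range (j + 1), s (j + 1 - l) * reciprocal s l) := by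
  rw [reciprocal, Fin.sum_univ_eq_sum_range (fun l => s (j + 1 - l) * reciprocal s l)]

variable {q : ℕ} {α : ℝ} {s : ℕ → Matrix (Fin q) (Fin q) ℂ}

theorem starSeries_mk (hs : ∀ j, (s j).IsHermitian) :
    starSeries (PowerSeries.mk s) = PowerSeries.mk s :=
  PowerSeries.ext fun j => by
    rw [starSeries, coeff_mk, coeff_mk]
    exact hs j

theorem starSeries_C_mul_mpInv (A : Matrix (Fin q) (Fin q) ℂ) :
    starSeries (C (A * mpInv A)) = C (A * mpInv A) := by
  rw [starSeries_C, star_eq_conjTranspose, (mpInv_spec A).isHermitian_left.eq]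

theorem C_mul_mk_mul_mk_reciprocal (s : ℕ → Matrix (Fin q) (Fin q) ℂ) :
    C (s 0 * mpInv (s 0)) * PowerSeries.mk s * PowerSeries.mk (reciprocal s) =
      C (s 0 * mpInv (s 0)) := by
  ext1 j
  rw [mul_assoc, coeff_C_mul, coeff_mul, ← Nat.sum_antidiagonal_swap,
    Nat.sum_antidiagonal_eq_sum_range_succ_mk, coeff_C]
  simp only [Prod.swap, coeff_mk]
  cases j with
  | zero =>
    rw [Finset.sum_range_one, reciprocal_zero, if_pos rfl, ← mul_assoc,
      (mpInv_spec (s 0)).mul_mul_left]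
  | succ j =>
    rw [Finset.sum_range_succ, if_neg (Nat.succ_ne_zero j), Nat.sub_self, reciprocal_succ,
      mul_neg, ← mul_assoc (s 0), mul_add, mul_neg, ← mul_assoc (s 0 * mpInv (s 0)) (_ * _),
      ← mul_assoc _ (s 0), (mpInv_spec (s 0)).mul_mul_left, add_neg_cancel]

theorem isCornerInverse_reciprocal (hs : ∀ j, (s j).IsHermitian) :
    IsCornerInverse (C (s 0 * mpInv (s 0))) (PowerSeries.mk s) (PowerSeries.mk (reciprocal s)) := by
  refine .of_right_inv (starSeries_C_mul_mpInv _) (starSeries_mk hs) ?_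
    (C_mul_mk_mul_mk_reciprocal s)
  have hproj : s 0 * mpInv (s 0) * mpInv (s 0) = mpInv (s 0) := by
    rw [← mul_mpInv_comm (hs 0), (mpInv_spec (s 0)).mul_mul_right]
  ext1 j
  rw [coeff_C_mul, coeff_mk]
  cases j with
  | zero => rw [reciprocal_zero, hproj]
  | succ j => rw [reciprocal_succ, mul_neg, ← mul_assoc, hproj]

theorem isHermitian_plusTransform (hs : ∀ j, (s j).IsHermitian) (j : ℕ) :
    (plusTransform (α : ℂ) s j).IsHermitian := by
  cases j with
  | zero => exact hs 0
  | succ j => exact ((hs j).smul (Complex.conj_ofReal α)).neg.add (hs (j + 1))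

theorem mk_plusTransform (a : ℂ) (s : ℕ → Matrix (Fin q) (Fin q) ℂ) :
    PowerSeries.mk (plusTransform a s) = (1 - a • X) * PowerSeries.mk s := by
  ext1 j
  rw [sub_mul, one_mul, smul_mul_assoc, map_sub, PowerSeries.coeff_smul]
  cases j with
  | zero => simp only [coeff_mk, coeff_zero_X_mul, smul_zero, sub_zero, plusTransform]
  | succ j => rw [coeff_succ_X_mul, coeff_mk, coeff_mk, coeff_mk, plusTransform, neg_add_eq_sub]

theorem isCornerInverse_plusTransform_reciprocal (hs : ∀ j, (s j).IsHermitian) :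
    IsCornerInverse (C (s 0 * mpInv (s 0))) (PowerSeries.mk s)
      (PowerSeries.mk (plusTransform (α : ℂ) (reciprocal (plusTransform (α : ℂ) s)))) := by
  have central (f : (Matrix (Fin q) (Fin q) ℂ)⟦X⟧) : Commute (1 - (α : ℂ) • X) f :=
    (Commute.one_left f).sub_left ((commute_X f).symm.smul_left _)
  rw [mk_plusTransform]
  refine .of_mul_central central ?_
  rw [← mk_plusTransform]
  exact isCornerInverse_reciprocal (isHermitian_plusTransform hs)

theorem shift_firstTransform (a : ℂ) (s : ℕ → Matrix (Fin q) (Fin q) ℂ) (j : ℕ) :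
    shift a (firstTransform a s) j =
      s 0 * -plusTransform a (reciprocal (plusTransform a s)) (j + 2) * s 0 := by
  simp only [shift, firstTransform, plusTransform, mul_neg, neg_mul, mul_add, add_mul,
    Matrix.mul_smul, Matrix.smul_mul, smul_neg, neg_add, neg_neg]

end Reciprocal

section Congr

variable {p q n : ℕ} {a : ℂ}

theorem plusTransform_congr {s s' : ℕ → Matrix (Fin p) (Fin q) ℂ} (h : ∀ j ≤ n, s j = s' j) :
    ∀ j ≤ n, plusTransform a s j = plusTransform a s' j
  | 0, hj => h 0 hj
  | j + 1, hj => by rw [plusTransform, plusTransform, h j (by omega), h _ hj]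

theorem reciprocal_congr {s s' : ℕ → Matrix (Fin p) (Fin q) ℂ} (h : ∀ j ≤ n, s j = s' j)
    (j : ℕ) (hj : j ≤ n) : reciprocal s j = reciprocal s' j := by
  induction j using Nat.strong_induction_on with
  | _ j ih =>
    cases j with
    | zero => rw [reciprocal_zero, reciprocal_zero, h 0 hj]
    | succ j =>
      rw [reciprocal_succ, reciprocal_succ, h 0 (Nat.zero_le n)]
      congr 2
      refine Finset.sum_congr rfl fun l hl => ?_
      have hlj := Finset.mem_range.1 hl
      rw [ih l hlj (by omega), h _ (by omega)]

theorem firstTransform_congr {s s' : ℕ → Matrix (Fin p) (Fin q) ℂ} (h : ∀ j ≤ n + 1, s j = s' j)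
    (j : ℕ) (hj : j ≤ n) : firstTransform a s j = firstTransform a s' j := by
  rw [firstTransform, firstTransform, h 0 (Nat.zero_le _),
    reciprocal_congr (plusTransform_congr h) (j + 1) (by omega)]

theorem transform_congr {s s' : ℕ → Matrix (Fin p) (Fin q) ℂ} {k : ℕ}
    (h : ∀ j ≤ n + k, s j = s' j) (j : ℕ) (hj : j ≤ n) :
    transform a k s j = transform a k s' j := by
  induction k generalizing n j with
  | zero => exact h j hj
  | succ k ih => exact firstTransform_congr (fun i hi => ih (n := n + 1) (by grind) i hi) j hj

variable {s s' : ℕ → Matrix (Fin q) (Fin q) ℂ}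

theorem shift_congr (h : ∀ j ≤ n + 1, s j = s' j) (j : ℕ) (hj : j ≤ n) :
    shift a s j = shift a s' j := by
  rw [shift, shift, h j (by omega), h (j + 1) (by omega)]

theorem hankelMatrix_congr {R : Type*} {h h' : ℕ → R} (hh : ∀ j ≤ 2 * n, h j = h' j) :
    hankelMatrix n h = hankelMatrix n h' :=
  Matrix.ext fun i k => hh _ (by omega)

theorem exists_forall_isHermitian (hs : ∀ j ≤ n, (s j).IsHermitian) :
    ∃ s' : ℕ → Matrix (Fin q) (Fin q) ℂ, (∀ j, (s' j).IsHermitian) ∧ ∀ j ≤ n, s j = s' j := by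
  refine ⟨fun j => if j ≤ n then s j else 0, fun j => ?_, fun j hj => (if_pos hj).symm⟩
  dsimp only
  split_ifs with hj
  · exact hs j hj
  · exact isHermitian_zero

end Congr

section FirstTransform

variable {q n : ℕ} {α : ℝ} {s : ℕ → Matrix (Fin q) (Fin q) ℂ}

theorem exists_toeplitz_congruence_firstTransform (hs : ∀ j ≤ 2 * n + 1, (s j).IsHermitian) :
    ∃ f g : (Matrix (Fin q) (Fin q) ℂ)⟦X⟧, g * f = C (s 0 * mpInv (s 0)) ∧ coeff 0 g = 1 ∧
      toeplitz n f * hankelMatrix n (shift (α : ℂ) s) * (toeplitz n f)ᴴ =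
        hankelMatrix n (firstTransform (α : ℂ) s) := by
  obtain ⟨s', hs', hss'⟩ := exists_forall_isHermitian hs
  rw [hss' 0 (Nat.zero_le _), hankelMatrix_congr (shift_congr hss'),
    hankelMatrix_congr (firstTransform_congr hss')]
  have hu := isHermitian_plusTransform (α := α) hs'
  have hinv := isCornerInverse_reciprocal hu
  obtain ⟨g, hg, hg0⟩ := hinv.exists_monic_left_inverse (coeff_mk 0 _) (mul_mpInv_comm (hu 0)) rfl
    (mpInv_spec _).mul_mul_left
  refine ⟨_, g, hg, hg0, ?_⟩
  have hstar := starSeries_eq_of_corner_right_inv (starSeries_C_mul_mpInv _) (starSeries_mk hu)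
    hinv.left_mul hinv.mul_mul_left
  have hK := hinv.toeplitz_congruence (hu 0) hstar n
  simp only [coeff_mk] at hK
  exact hK

theorem exists_toeplitz_congruence_shift_firstTransform
    (hs : ∀ j ≤ 2 * n + 2, (s j).IsHermitian) :
    ∃ f g : (Matrix (Fin q) (Fin q) ℂ)⟦X⟧, g * f = C (s 0 * mpInv (s 0)) ∧ coeff 0 g = 1 ∧
      (toeplitz (n + 1) f * hankelMatrix (n + 1) s * (toeplitz (n + 1) f)ᴴ).submatrix
        Fin.succ Fin.succ = hankelMatrix n (shift (α : ℂ) (firstTransform (α : ℂ) s)) ∧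
      ∀ i : Fin (n + 1),
        (toeplitz (n + 1) f * hankelMatrix (n + 1) s * (toeplitz (n + 1) f)ᴴ) i.succ 0 = 0 := by
  obtain ⟨s', hs', hss'⟩ := exists_forall_isHermitian hs
  rw [hss' 0 (Nat.zero_le _), hankelMatrix_congr hss',
    hankelMatrix_congr (shift_congr (firstTransform_congr hss'))]
  have hinv := isCornerInverse_plusTransform_reciprocal (α := α) hs'
  obtain ⟨g, hg, hg0⟩ := hinv.exists_monic_left_inverse (coeff_mk 0 _) (mul_mpInv_comm (hs' 0)) rfl
    (mpInv_spec _).mul_mul_left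
  have hstar := starSeries_eq_of_corner_right_inv (starSeries_C_mul_mpInv _) (starSeries_mk hs')
    hinv.left_mul hinv.mul_mul_left
  refine ⟨_, g, hg, hg0, ?_⟩
  rw [mul_conjTranspose_toeplitz_C_mul (hs' 0) hstar]
  constructor
  · ext1 i k
    have entry := congrFun₂ (hinv.toeplitz_mul_hankelMatrix_mul_submatrix n) i k
    simp only [coeff_mk, submatrix_apply] at entry
    rw [submatrix_apply, toeplitz_C_mul_mul_toeplitz_C_transpose_apply, entry, hankelMatrix,
      hankelMatrix, of_apply, of_apply, shift_firstTransform]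
  · intro i
    have entry := hinv.toeplitz_mul_hankelMatrix_mul_succ_zero i
    simp only [coeff_mk] at entry
    rw [toeplitz_C_mul_mul_toeplitz_C_transpose_apply, entry, mul_zero, zero_mul]

theorem HankelNonneg.toeplitz_congr (h : HankelNonneg n s) (f : (Matrix (Fin q) (Fin q) ℂ)⟦X⟧) :
    (compRingEquiv (Fin (n + 1)) (Fin q) ℂ
      (toeplitz n f * hankelMatrix n s * (toeplitz n f)ᴴ)).PosSemidef := by
  rw [map_mul, map_mul]
  exact PosSemidef.mul_mul_conjTranspose_same h _

theorem HankelPos.toeplitz_congr (h : HankelPos n s) {f g : (Matrix (Fin q) (Fin q) ℂ)⟦X⟧}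
    (hgf : g * f = 1) :
    (compRingEquiv (Fin (n + 1)) (Fin q) ℂ
      (toeplitz n f * hankelMatrix n s * (toeplitz n f)ᴴ)).PosDef := by
  rw [map_mul, map_mul]
  have hinv : toeplitz n g * toeplitz n f = 1 := by rw [← toeplitz_mul, hgf, toeplitz_one]
  have hunit : IsUnit (compRingEquiv (Fin (n + 1)) (Fin q) ℂ (toeplitz n f)) := by
    refine IsUnit.of_mul_eq_one_right (compRingEquiv (Fin (n + 1)) (Fin q) ℂ (toeplitz n g)) ?_
    rw [← map_mul, hinv]
    exact comp_one
  exact PosDef.mul_mul_conjTranspose_same h (vecMul_injective_of_isUnit hunit)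

theorem HankelPos.mul_mpInv_eq_one (h : HankelPos n s) : s 0 * mpInv (s 0) = 1 := by
  have h0 : (s 0).PosDef :=
    PosDef.submatrix h (e := Prod.mk (0 : Fin (n + 1))) (Prod.mk_right_injective _)
  exact h0.isUnit.mul_right_cancel ((mpInv_spec (s 0)).mul_mul_left.trans (one_mul _).symm)

theorem hankelNonneg_firstTransform (hs : ∀ j ≤ 2 * n + 1, (s j).IsHermitian)
    (h : HankelNonneg n (shift (α : ℂ) s)) : HankelNonneg n (firstTransform (α : ℂ) s) := by
  obtain ⟨f, -, -, -, hK⟩ := exists_toeplitz_congruence_firstTransform (α := α) hs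
  rw [HankelNonneg, ← compRingEquiv_hankelMatrix, ← hK]
  exact h.toeplitz_congr f

theorem hankelNonneg_shift_firstTransform (hs : ∀ j ≤ 2 * n + 2, (s j).IsHermitian)
    (h : HankelNonneg (n + 1) s) : HankelNonneg n (shift (α : ℂ) (firstTransform (α : ℂ) s)) := by
  obtain ⟨f, -, -, -, hK, -⟩ := exists_toeplitz_congruence_shift_firstTransform (α := α) hs
  rw [HankelNonneg, ← compRingEquiv_hankelMatrix, ← hK]
  exact (h.toeplitz_congr f).submatrix (Prod.map Fin.succ id)

theorem hankelPos_firstTransform (hs : ∀ j ≤ 2 * n + 1, (s j).IsHermitian)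
    (h0 : s 0 * mpInv (s 0) = 1) (h : HankelPos n (shift (α : ℂ) s)) :
    HankelPos n (firstTransform (α : ℂ) s) := by
  obtain ⟨f, g, hgf, -, hK⟩ := exists_toeplitz_congruence_firstTransform (α := α) hs
  rw [h0, map_one] at hgf
  rw [HankelPos, ← compRingEquiv_hankelMatrix, ← hK]
  exact h.toeplitz_congr hgf

theorem hankelPos_shift_firstTransform (hs : ∀ j ≤ 2 * n + 2, (s j).IsHermitian)
    (h : HankelPos (n + 1) s) : HankelPos n (shift (α : ℂ) (firstTransform (α : ℂ) s)) := by
  obtain ⟨f, g, hgf, -, hK, -⟩ := exists_toeplitz_congruence_shift_firstTransform (α := α) hs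
  rw [h.mul_mpInv_eq_one, map_one] at hgf
  rw [HankelPos, ← compRingEquiv_hankelMatrix, ← hK]
  exact (h.toeplitz_congr hgf).submatrix (e := Prod.map Fin.succ id)
    ((Fin.succ_injective _).prodMap Function.injective_id)

theorem hankelMatrix_mul_toeplitz_C {R : Type*} [Ring R] {h : ℕ → R} {e : R}
    (he : ∀ j ≤ 2 * n, h j * e = h j) : hankelMatrix n h * toeplitz n (C e) = hankelMatrix n h := by
  ext1 i k
  rw [toeplitz_C, mul_diagonal]
  exact he _ (by omega)

theorem schurL_firstTransform_eq_zero (hs : ∀ j ≤ 2 * n + 1, (s j).IsHermitian)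
    (he : ∀ j ≤ 2 * n, s j * (s 0 * mpInv (s 0)) = s j) (h : HankelNonneg n (shift (α : ℂ) s))
    (hL : schurL (shift (α : ℂ) s) n = 0) : schurL (firstTransform (α : ℂ) s) n = 0 := by
  have heShift (j : ℕ) (hj : j < 2 * n) :
      shift (α : ℂ) s j * (s 0 * mpInv (s 0)) = shift (α : ℂ) s j := by
    rw [shift, add_mul, neg_mul, Matrix.smul_mul, he j hj.le, he (j + 1) hj]
  obtain ⟨f, g, hgf, hg, hK⟩ := exists_toeplitz_congruence_firstTransform (α := α) hs
  rw [schurL_eq_zero_iff (hankelNonneg_firstTransform hs h), ← hK]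
  exact ((schurL_eq_zero_iff h).1 hL).toeplitz_congr hgf hg (mpInv_spec _).isHermitian_left
    (hankelMatrix_mul_toeplitz_C (mul_eq_self_of_schurL_eq_zero hL heShift))

theorem schurL_shift_firstTransform_eq_zero (hs : ∀ j ≤ 2 * n + 2, (s j).IsHermitian)
    (he : ∀ j < 2 * n + 2, s j * (s 0 * mpInv (s 0)) = s j) (h : HankelNonneg (n + 1) s)
    (hL : schurL s (n + 1) = 0) :
    schurL (shift (α : ℂ) (firstTransform (α : ℂ) s)) n = 0 := by
  obtain ⟨f, g, hgf, hg, hK, hcol⟩ := exists_toeplitz_congruence_shift_firstTransform (α := α) hs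
  rw [schurL_eq_zero_iff (hankelNonneg_shift_firstTransform hs h), ← hK]
  exact (((schurL_eq_zero_iff h).1 hL).toeplitz_congr hgf hg (mpInv_spec _).isHermitian_left
    (hankelMatrix_mul_toeplitz_C (mul_eq_self_of_schurL_eq_zero hL he))).submatrix_succ hcol

end FirstTransform

section FiniteClasses

variable {q m : ℕ} {α : ℝ} {s : ℕ → Matrix (Fin q) (Fin q) ℂ}

theorem kNonnegFin_iff : KNonnegFin α m s ↔ (∀ n, 2 * n ≤ m → HankelNonneg n s) ∧
    ∀ n, 2 * n + 1 ≤ m → HankelNonneg n (shift (α : ℂ) s) := by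
  cases m with
  | zero =>
    exact ⟨fun h => ⟨fun n hn => h.mono (by omega), fun n hn => by omega⟩,
      fun h => h.1 0 le_rfl⟩
  | succ m =>
    exact ⟨fun h => ⟨fun n hn => h.1.mono (by omega), fun n hn => h.2.mono (by omega)⟩,
      fun h => ⟨h.1 _ (by omega), h.2 _ (by omega)⟩⟩

theorem kPosFin_iff : KPosFin α m s ↔ (∀ n, 2 * n ≤ m → HankelPos n s) ∧
    ∀ n, 2 * n + 1 ≤ m → HankelPos n (shift (α : ℂ) s) := by
  cases m with
  | zero =>
    exact ⟨fun h => ⟨fun n hn => h.mono (by omega), fun n hn => by omega⟩,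
      fun h => h.1 0 le_rfl⟩
  | succ m =>
    exact ⟨fun h => ⟨fun n hn => h.1.mono (by omega), fun n hn => h.2.mono (by omega)⟩,
      fun h => ⟨h.1 _ (by omega), h.2 _ (by omega)⟩⟩

theorem kCdFin_iff : KCdFin α m s ↔ KNonnegFin α m s ∧ (∀ n, m = 2 * n → schurL s n = 0) ∧
    ∀ n, m = 2 * n + 1 → schurL (shift (α : ℂ) s) n = 0 := by
  refine and_congr_right fun h => and_congr ⟨?_, ?_⟩ ⟨?_, ?_⟩
  · rintro hcd n rfl
    simpa only [Nat.mul_div_cancel_left _ zero_lt_two] using (hcd (even_two_mul n)).2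
  · exact fun hL hm => ⟨(kNonnegFin_iff.1 h).1 _ (by omega), hL _ (by grind)⟩
  · rintro hcd n rfl
    simpa only [show (2 * n + 1) / 2 = n by omega] using (hcd (odd_two_mul_add_one n)).2
  · exact fun hL hm => ⟨(kNonnegFin_iff.1 h).2 _ (by grind), hL _ (by grind)⟩

theorem KNonnegFin.mono {m' : ℕ} (hm : m' ≤ m) (h : KNonnegFin α m s) : KNonnegFin α m' s := by
  rw [kNonnegFin_iff] at h ⊢
  exact ⟨fun n hn => h.1 n (hn.trans hm), fun n hn => h.2 n (hn.trans hm)⟩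

theorem KPosFin.mono {m' : ℕ} (hm : m' ≤ m) (h : KPosFin α m s) : KPosFin α m' s := by
  rw [kPosFin_iff] at h ⊢
  exact ⟨fun n hn => h.1 n (hn.trans hm), fun n hn => h.2 n (hn.trans hm)⟩

theorem KPosFin.kNonnegFin (h : KPosFin α m s) : KNonnegFin α m s := by
  rw [kPosFin_iff] at h
  exact kNonnegFin_iff.2 ⟨fun n hn => (h.1 n hn).posSemidef, fun n hn => (h.2 n hn).posSemidef⟩

theorem KNonnegFin.congr {s' : ℕ → Matrix (Fin q) (Fin q) ℂ} (hss' : ∀ j ≤ m, s j = s' j)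
    (h : KNonnegFin α m s) : KNonnegFin α m s' := by
  have hankel_eq {n : ℕ} {t t' : ℕ → Matrix (Fin q) (Fin q) ℂ} (ht : ∀ j ≤ 2 * n, t j = t' j) :
      hankel n t = hankel n t' := by
    rw [← compRingEquiv_hankelMatrix, hankelMatrix_congr ht, compRingEquiv_hankelMatrix]
  rw [kNonnegFin_iff] at h ⊢
  refine ⟨fun n hn => ?_, fun n hn => ?_⟩
  · rw [HankelNonneg, ← hankel_eq fun j hj => hss' j (hj.trans hn)]
    exact h.1 n hn
  · rw [HankelNonneg, ← hankel_eq (shift_congr fun j hj => hss' j (hj.trans hn))]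
    exact h.2 n hn

theorem KNonnegFin.isHermitian (h : KNonnegFin α m s) (j : ℕ) (hj : j ≤ m) :
    (s j).IsHermitian := by
  rw [kNonnegFin_iff] at h
  have even {n : ℕ} (hn : 2 * n ≤ m) : (s (2 * n)).IsHermitian := (h.1 n hn).isHermitian le_rfl
  obtain ⟨n, rfl | rfl⟩ := j.even_or_odd'
  · exact even hj
  · have hshift : (shift (α : ℂ) s (2 * n)).IsHermitian := (h.2 n hj).isHermitian le_rfl
    have hsum : s (2 * n + 1) = shift (α : ℂ) s (2 * n) + (α : ℂ) • s (2 * n) := by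
      rw [shift, neg_add_cancel_comm]
    rw [hsum]
    exact hshift.add ((even (by omega)).smul (Complex.conj_ofReal α))

theorem KNonnegFin.mul_eq_zero (h : KNonnegFin α m s) {Q : Matrix (Fin q) (Fin q) ℂ}
    (hQ : s 0 * Q = 0) (j : ℕ) (hj : j < m) : s j * Q = 0 := by
  have shift_mul (i : ℕ) (hi : s i * Q = 0) : shift (α : ℂ) s i * Q = s (i + 1) * Q := by
    rw [shift, add_mul, neg_mul, Matrix.smul_mul, hi, smul_zero, neg_zero, zero_add]
  rw [kNonnegFin_iff] at h
  induction j using Nat.strong_induction_on with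
  | _ j ih =>
    obtain ⟨n, rfl | rfl⟩ := j.even_or_odd'
    · cases n with
      | zero => exact hQ
      | succ n =>
        have hodd : s (2 * n + 1) * Q = 0 := ih _ (by omega) (by omega)
        have hshift := (h.2 (n + 1) hj).mul_eq_zero (i := n) (l := n + 1) (by omega) le_rfl
          (Q := Q) (by
            rw [← two_mul, shift_mul _ (ih (2 * n) (by omega) (by omega)), hodd])
        rwa [show n + 1 + n = 2 * n + 1 by omega, shift_mul _ hodd] at hshift
    · have heven : s (n + n) * Q = 0 := ih _ (by omega) (by omega)
      rw [show 2 * n + 1 = n + 1 + n by omega]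
      exact (h.1 (n + 1) hj).mul_eq_zero (by omega) le_rfl heven

theorem KNonnegFin.mul_mul_mpInv (h : KNonnegFin α m s) (j : ℕ) (hj : j < m) :
    s j * (s 0 * mpInv (s 0)) = s j := by
  have hker : s 0 * (1 - s 0 * mpInv (s 0)) = 0 := by
    rw [← mul_mpInv_comm (h.isHermitian 0 (Nat.zero_le m)), mul_sub, mul_one, ← mul_assoc,
      (mpInv_spec (s 0)).mul_mul_left, sub_self]
  have hj0 := h.mul_eq_zero hker j hj
  rwa [mul_sub, mul_one, sub_eq_zero, eq_comm] at hj0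

theorem kNonnegFin_firstTransform (h : KNonnegFin α (m + 1) s) :
    KNonnegFin α m (firstTransform (α : ℂ) s) := by
  have herm := h.isHermitian
  rw [kNonnegFin_iff] at h ⊢
  exact ⟨fun n hn => hankelNonneg_firstTransform (by grind) (h.2 n (by omega)),
    fun n hn => hankelNonneg_shift_firstTransform (by grind) (h.1 (n + 1) (by omega))⟩

theorem kPosFin_firstTransform (h : KPosFin α (m + 1) s) :
    KPosFin α m (firstTransform (α : ℂ) s) := by
  have herm := h.kNonnegFin.isHermitian
  rw [kPosFin_iff] at h ⊢
  have h0 := (h.1 0 (Nat.zero_le _)).mul_mpInv_eq_one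
  exact ⟨fun n hn => hankelPos_firstTransform (by grind) h0 (h.2 n (by omega)),
    fun n hn => hankelPos_shift_firstTransform (by grind) (h.1 (n + 1) (by omega))⟩

theorem kCdFin_zero_firstTransform (h : KCdFin α 0 s) :
    KCdFin α 0 (firstTransform (α : ℂ) s) := by
  have h0 : s 0 = 0 := (kCdFin_iff.1 h).2.1 0 rfl
  have hzero : firstTransform (α : ℂ) s 0 = 0 := by rw [firstTransform, h0, mul_zero]
  refine kCdFin_iff.2 ⟨?_, fun n hn => ?_, fun n hn => by omega⟩
  · exact KNonnegFin.congr (s := 0) (fun j hj => by rw [Nat.le_zero.1 hj, hzero, Pi.zero_apply])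
      PosSemidef.zero
  · obtain rfl : n = 0 := by omega
    exact hzero

theorem kCdFin_firstTransform (h : KCdFin α m s) :
    KCdFin α (m - 1) (firstTransform (α : ℂ) s) := by
  cases m with
  | zero => exact kCdFin_zero_firstTransform h
  | succ m =>
    obtain ⟨hK, hL, hLshift⟩ := kCdFin_iff.1 h
    obtain ⟨hH, hHshift⟩ := kNonnegFin_iff.1 hK
    refine kCdFin_iff.2 ⟨kNonnegFin_firstTransform hK, ?_, ?_⟩
    · rintro n rfl
      exact schurL_firstTransform_eq_zero hK.isHermitian
        (fun j hj => hK.mul_mul_mpInv j (Nat.lt_succ_of_le hj)) (hHshift n le_rfl) (hLshift n rfl)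
    · rintro n rfl
      exact schurL_shift_firstTransform_eq_zero hK.isHermitian hK.mul_mul_mpInv
        (hH (n + 1) le_rfl) (hL (n + 1) rfl)

theorem transform_induction {P : ℕ → (ℕ → Matrix (Fin q) (Fin q) ℂ) → Prop} {a : ℂ}
    (hP : ∀ m t, P (m + 1) t → P m (firstTransform a t)) {k : ℕ} (h : P (m + k) s) :
    P m (transform a k s) := by
  induction k generalizing m with
  | zero => exact h
  | succ k ih => exact hP m _ (ih (by rwa [Nat.add_right_comm]))

theorem kNonnegFin_transform {k : ℕ} (h : KNonnegFin α (m + k) s) :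
    KNonnegFin α m (transform (α : ℂ) k s) :=
  transform_induction (P := KNonnegFin α) (fun _ _ => kNonnegFin_firstTransform) h

theorem kPosFin_transform {k : ℕ} (h : KPosFin α (m + k) s) :
    KPosFin α m (transform (α : ℂ) k s) :=
  transform_induction (P := KPosFin α) (fun _ _ => kPosFin_firstTransform) h

theorem kCdFin_transform {k : ℕ} (h : KCdFin α m s) :
    KCdFin α (m - k) (transform (α : ℂ) k s) := by
  induction k with
  | zero => exact h
  | succ k ih => exact kCdFin_firstTransform ih

end FiniteClasses

section Classes

variable {q k : ℕ} {α : ℝ} {κ : ℕ∞} {s : ℕ → Matrix (Fin q) (Fin q) ℂ}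

theorem kNonneg_iff : KNonneg α κ s ↔ ∀ m : ℕ, m ≤ κ → KNonnegFin α m s := by
  induction κ using ENat.recTopCoe with
  | top => exact ⟨fun h m _ => h m, fun h m => h m le_top⟩
  | coe n => exact ⟨fun h m hm => h.mono (Nat.cast_le.1 hm), fun h => h n le_rfl⟩

theorem kPos_iff : KPos α κ s ↔ ∀ m : ℕ, m ≤ κ → KPosFin α m s := by
  induction κ using ENat.recTopCoe with
  | top => exact ⟨fun h m _ => h m, fun h m => h m le_top⟩
  | coe n => exact ⟨fun h m hm => h.mono (Nat.cast_le.1 hm), fun h => h n le_rfl⟩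

theorem kNonnegExt_coe_iff {m : ℕ} : KNonnegExt α m s ↔
    ∃ s' : ℕ → Matrix (Fin q) (Fin q) ℂ, (∀ j ≤ m, s j = s' j) ∧ KNonnegFin α (m + 1) s' := by
  constructor
  · exact fun ⟨A, hA⟩ => ⟨Function.update s (m + 1) A,
      fun j hj => (Function.update_of_ne (Nat.lt_succ_of_le hj).ne A s).symm, hA⟩
  · rintro ⟨s', hss', h⟩
    refine ⟨s' (m + 1), h.congr fun j hj => ?_⟩
    rcases Nat.le_succ_iff.1 hj with hjm | rfl
    · rw [Function.update_of_ne (by omega), hss' j hjm]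
    · rw [Function.update_self]

theorem kNonneg_transform (hk : (k : ℕ∞) ≤ κ) (h : KNonneg α κ s) :
    KNonneg α (κ - k) (transform (α : ℂ) k s) :=
  kNonneg_iff.2 fun m hm => kNonnegFin_transform <| kNonneg_iff.1 h (m + k) <| by
    exact_mod_cast add_le_of_le_tsub_right_of_le hk hm

theorem kPos_transform (hk : (k : ℕ∞) ≤ κ) (h : KPos α κ s) :
    KPos α (κ - k) (transform (α : ℂ) k s) :=
  kPos_iff.2 fun m hm => kPosFin_transform <| kPos_iff.1 h (m + k) <| by
    exact_mod_cast add_le_of_le_tsub_right_of_le hk hm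

theorem kNonnegExt_transform (hk : (k : ℕ∞) ≤ κ) (h : KNonnegExt α κ s) :
    KNonnegExt α (κ - k) (transform (α : ℂ) k s) := by
  induction κ using ENat.recTopCoe with
  | top =>
    rw [ENat.top_sub_natCast]
    exact kNonneg_transform le_top h
  | coe m =>
    obtain ⟨n, rfl⟩ := Nat.exists_eq_add_of_le' (Nat.cast_le.1 hk)
    obtain ⟨s', hss', h'⟩ := kNonnegExt_coe_iff.1 h
    rw [← ENat.natCast_sub, Nat.add_sub_cancel, kNonnegExt_coe_iff]
    exact ⟨transform (α : ℂ) k s', transform_congr hss',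
      kNonnegFin_transform (by rwa [Nat.add_right_comm])⟩

theorem kCd_transform (h : KCd α κ s) :
    KCd α (κ - k) (transform (α : ℂ) k s) := by
  induction κ using ENat.recTopCoe with
  | top =>
    obtain ⟨hK, m, hm⟩ := h
    rw [ENat.top_sub_natCast]
    exact ⟨kNonneg_transform le_top hK, m - k, kCdFin_transform hm⟩
  | coe m =>
    rw [← ENat.natCast_sub]
    exact kCdFin_transform h

end Classes

end SchurStieltjes

theorem theoremP1410 (q : ℕ) (α : ℝ) (κ : ℕ∞) (s : ℕ → Matrix (Fin q) (Fin q) ℂ)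
    (k : ℕ) (hk : (k : ℕ∞) ≤ κ) :
    (SchurStieltjes.KNonneg α κ s →
      SchurStieltjes.KNonneg α (κ - k) (SchurStieltjes.transform (α : ℂ) k s)) ∧
    (SchurStieltjes.KNonnegExt α κ s →
      SchurStieltjes.KNonnegExt α (κ - k) (SchurStieltjes.transform (α : ℂ) k s)) ∧
    (SchurStieltjes.KPos α κ s →
      SchurStieltjes.KPos α (κ - k) (SchurStieltjes.transform (α : ℂ) k s)) ∧
    (∀ m : ℕ, (m : ℕ∞) ≤ κ → SchurStieltjes.KCdOrder α m κ s →
      SchurStieltjes.KCdOrder α (m - k) (κ - k) (SchurStieltjes.transform (α : ℂ) k s)) ∧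
    (SchurStieltjes.KCd α κ s →
      SchurStieltjes.KCd α (κ - k) (SchurStieltjes.transform (α : ℂ) k s)) :=
  open SchurStieltjes in
  ⟨kNonneg_transform hk, kNonnegExt_transform hk, kPos_transform hk,
    fun _ _ h => ⟨kNonneg_transform hk h.1, kCdFin_transform h.2⟩, kCd_transform⟩
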